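/- Let $K$ be a simplicial 2-complex given by a (locally finite, topological) triangulation of an open domain, i.e. a non-empty connected open set, in $\mathbf C$, oriented by the orientation of $\mathbf C$; in particular $K$ has no boundary. Assume that the 1-skeleton of $K$ is a recurrent graph: the simple random walk on it, started at any vertex, almost surely visits every vertex infinitely many times. A *circle packing* $P$ for $K$ is a family of circles $C_P(v)$ in $\mathbf C$ of radii $r_P(v)>0$, indexed by the vertices $v$ of $K$, such that for every positively oriented triangle $\langle u,v,w\rangle$ of $K$ the circles $C_P(u),C_P(v),C_P(w)$ form a positively oriented triple of mutually externally tangent circles (disjointness of interiors for other circles is not required). For a vertex $v$ of a triangle $\triangle=\langle v,u,w\rangle$ put $$\alpha_P(v,\triangle)=\arccos\frac{(r_P(v)+r_P(u))^2+(r_P(v)+r_P(w))^2-(r_P(u)+r_P(w))^2}{2(r_P(v)+r_P(u))(r_P(v)+r_P(w))},$$ and let the *angle sum* of $P$ at $v$ be $\Theta_P(v)=\sum_{\triangle\ni v}\alpha_P(v,\triangle)$, the sum over all triangles of $K$ that contain $v$. For circle packings $P,Q$ for $K$, the *ratio function* from $P$ to $Q$ is the function on the underlying surface of $P$ (identified with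 the polyhedron $|K|$) that equals $r_Q(v)/r_P(v)$ at each vertex $v$ and is affine on each edge and each triangle. Let $P$ and $Q$ be circle packings for $K$ with $\Theta_P(v)=\Theta_Q(v)$ for every vertex $v$ of $K$. Then either the ratio function from $P$ to $Q$ and the ratio function from $Q$ to $P$ are both unbounded, or they are both constant. -/

import Mathlib

open MeasureTheory Filter Topology

noncomputable section

namespace CirclePack

/-- The geometric realization of an abstract simplicial complex, in barycentric coordinates, as a
set of points of `V → ℝ` with the topology of coordinatewise convergence. For locally finite
complexes (the only ones used below) this is the usual topology of the polyhedron. -/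
def realization {V : Type*} (K : AbstractSimplicialComplex V) : Set (V → ℝ) :=
  {x | (∀ v, 0 ≤ x v) ∧ ∃ T ∈ K.faces, Function.support x ⊆ (T : Set V) ∧ ∑ v ∈ T, x v = 1}

/-- A simplicial 2-complex (without boundary) given by a triangulation of an open domain of `ℂ`:
a pure two-dimensional, locally finite complex in which each edge lies on exactly two triangles,
together with a homeomorphism `toPlane` of its geometric realization onto a domain (a non-empty
connected open subset) of `ℂ`. The triangulation is a topological one: the edges need not be
straight. The values of `toPlane` off the realization are irrelevant. -/
structure PlaneTriangulation (V : Type*) extends AbstractSimplicialComplex V where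
  card_le_three : ∀ S ∈ faces, S.card ≤ 3
  exists_triangle : ∀ S ∈ faces, ∃ T ∈ faces, S ⊆ T ∧ T.card = 3
  finite_star : ∀ v : V, {T | T ∈ faces ∧ T.card = 3 ∧ v ∈ T}.Finite
  edge_two : ∀ e ∈ faces, e.card = 2 → {T | T ∈ faces ∧ T.card = 3 ∧ e ⊆ T}.ncard = 2
  toPlane : (V → ℝ) → ℂ
  isOpenEmbedding_toPlane :
    IsOpenEmbedding ((realization toAbstractSimplicialComplex).domRestrict toPlane)
  isConnected_domain : IsConnected (toPlane '' realization toAbstractSimplicialComplex)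

namespace PlaneTriangulation

variable {V : Type*} (K : PlaneTriangulation V)

/-- The set of triangles (2-simplices) of `K`. -/
def triangles : Set (Finset V) := {T | T ∈ K.faces ∧ T.card = 3}

/-- The finite set of triangles of `K` that have `v` as a vertex. -/
def star (v : V) : Finset (Finset V) := (K.finite_star v).toFinset

/-- The underlying polyhedron of `K`, as a set of points in barycentric coordinates. -/
def polyhedron : Set (V → ℝ) := realization K.toAbstractSimplicialComplex

/-- The 1-skeleton of `K`, as a graph. -/
def skeleton [DecidableEq V] : SimpleGraph V where
  Adj u v := u ≠ v ∧ ({u, v} : Finset V) ∈ K.faces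
  symm := ⟨fun _ _ h => ⟨h.1.symm, by rw [Finset.pair_comm]; exact h.2⟩⟩
  loopless := ⟨fun _ h => h.1 rfl⟩

end PlaneTriangulation

/-- The boundary of the triangle `u v w` in barycentric coordinates, as a loop parametrized
piecewise affinely by `t ∈ [0, 3]`, at `u`, `v`, `w`, `u` for `t = 0, 1, 2, 3`. -/
def boundaryLoop {V : Type*} [DecidableEq V] (u v w : V) (t : ℝ) : V → ℝ := fun x =>
  if x = u then max 0 (1 - t) + max 0 (t - 2)
  else if x = v then max 0 (1 - |t - 1|)
  else if x = w then max 0 (1 - |t - 2|)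
  else 0

/-- The barycenter of the triangle `u v w` in barycentric coordinates. -/
def barycenter {V : Type*} [DecidableEq V] (u v w : V) : V → ℝ := fun x =>
  if x = u ∨ x = v ∨ x = w then 1 / 3 else 0

/-- `(u, v, w)` is a positively oriented triangle of `K`, for the orientation induced from `ℂ`:
the image in the plane of the boundary loop `u → v → w → u` winds exactly once, counterclockwise,
around the image of the barycenter (`θ` is a continuous branch of the argument along the loop). -/
def PlaneTriangulation.PosTriangle {V : Type*} [DecidableEq V] (K : PlaneTriangulation V)
    (u v w : V) : Prop :=
  u ≠ v ∧ v ≠ w ∧ w ≠ u ∧ ({u, v, w} : Finset V) ∈ K.faces ∧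
    ∃ θ : ℝ → ℝ, ContinuousOn θ (Set.Icc 0 3) ∧
      (∀ t ∈ Set.Icc (0 : ℝ) 3,
        K.toPlane (boundaryLoop u v w t) - K.toPlane (barycenter u v w) =
          (‖K.toPlane (boundaryLoop u v w t) - K.toPlane (barycenter u v w)‖ : ℂ) *
            Complex.exp (θ t * Complex.I)) ∧
      θ 3 - θ 0 = 2 * Real.pi

/-- For a label `ρ`, the angle at the vertex `v` of the triangle `T = {v, u, w}`,
`arccos (((ρ v + ρ u)² + (ρ v + ρ w)² - (ρ u + ρ w)²) / (2 (ρ v + ρ u) (ρ v + ρ w)))`,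
that is, the angle at `v` of the euclidean triangle with sides `ρ v + ρ u`, `ρ v + ρ w`,
`ρ u + ρ w`. Here `T.erase v = {u, w}`, and `v` is meant to be a vertex of `T`. -/
def angle {V : Type*} [DecidableEq V] (ρ : V → ℝ) (v : V) (T : Finset V) : ℝ :=
  Real.arccos ((∑ x ∈ T.erase v, (ρ v + ρ x) ^ 2 - (∑ x ∈ T.erase v, ρ x) ^ 2) /
    (2 * ∏ x ∈ T.erase v, (ρ v + ρ x)))

/-- The angle sum of the label `ρ` at the vertex `v`. -/
def PlaneTriangulation.angleSum {V : Type*} [DecidableEq V] (K : PlaneTriangulation V)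
    (ρ : V → ℝ) (v : V) : ℝ :=
  ∑ T ∈ K.star v, angle ρ v T

/-- A circle packing for `K`: circles indexed by the vertices of `K` (not necessarily with disjoint
interiors) such that the three circles of each positively oriented triangle `(u, v, w)` are
mutually externally tangent and positively oriented, i.e. their centers are the vertices of a
euclidean triangle in counterclockwise order. -/
structure CirclePacking {V : Type*} [DecidableEq V] (K : PlaneTriangulation V) where
  center : V → ℂ
  radius : V → ℝ
  radius_pos : ∀ v, 0 < radius v
  tangent : ∀ u v w, K.PosTriangle u v w →
    dist (center u) (center v) = radius u + radius v ∧
    dist (center v) (center w) = radius v + radius w ∧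
    dist (center w) (center u) = radius w + radius u
  oriented : ∀ u v w, K.PosTriangle u v w →
    0 < ((starRingEnd ℂ) (center v - center u) * (center w - center u)).im

/-- The angle sum of the circle packing `P` at the vertex `v`. -/
def CirclePacking.angleSum {V : Type*} [DecidableEq V] {K : PlaneTriangulation V}
    (P : CirclePacking K) (v : V) : ℝ :=
  K.angleSum P.radius v

/-- The ratio function from `P` to `Q`, on the underlying surface of `P` (which is the polyhedron
of `K`): at a vertex `v` it is `r_Q(v) / r_P(v)`, and it is affine on each edge and triangle.
The sum is finite, since a point of the polyhedron has at most three non-zero coordinates. -/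
def ratioFunction {V : Type*} [DecidableEq V] {K : PlaneTriangulation V}
    (P Q : CirclePacking K) (x : K.polyhedron) : ℝ :=
  ∑ᶠ v, (x : V → ℝ) v * (Q.radius v / P.radius v)

/-- Boundedness of a (non-negative) real function. -/
def IsBoundedFun {X : Type*} (f : X → ℝ) : Prop := ∃ M : ℝ, ∀ x, |f x| ≤ M

/-- Constancy of a real function. -/
def IsConstantFun {X : Type*} (f : X → ℝ) : Prop := ∃ c : ℝ, ∀ x, f x = c

open Classical in
/-- The transition probabilities of the simple random walk on a (locally finite) graph. -/
def simpleWalk {V : Type*} (G : SimpleGraph V) (v w : V) : ℝ :=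
  if G.Adj v w then 1 / ((G.neighborSet v).ncard : ℝ) else 0

/-- `μ` is the law, on the space of trajectories, of the random walk with transition
probabilities `p` started at `v`. -/
def IsWalkLaw {V : Type*} [DecidableEq V] [MeasurableSpace V] (p : V → V → ℝ) (v : V)
    (μ : Measure (ℕ → V)) : Prop :=
  IsProbabilityMeasure μ ∧ ∀ (n : ℕ) (x : ℕ → V),
    μ.real {ω | ∀ i ≤ n, ω i = x i} =
      (if x 0 = v then 1 else 0) * ∏ i ∈ Finset.range n, p (x i) (x (i + 1))

/-- A random walk is recurrent if, from each starting point, almost surely every vertex is visited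
infinitely many times. (The vertex set is discrete; the law of the walk from `v` is determined
by its finite-dimensional distributions.) -/
def IsRecurrentWalk {V : Type*} [DecidableEq V] (p : V → V → ℝ) : Prop :=
  letI : MeasurableSpace V := ⊤
  ∀ v : V, ∃ μ : Measure (ℕ → V), IsWalkLaw p v μ ∧
    ∀ᵐ ω ∂μ, ∀ w : V, ∃ᶠ n in atTop, ω n = w

/-- A graph is recurrent if its simple random walk is. -/
def IsRecurrentGraph {V : Type*} [DecidableEq V] (G : SimpleGraph V) : Prop :=
  IsRecurrentWalk (simpleWalk G)

end CirclePack

end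

-- Join the two families of radii by log-linear interpolation. In a triangle of tangent circles, the
-- angle at one center depends on the log-radii with partial derivatives inradius divided by edge
-- length, which are symmetric in the two ends of the edge. Integrating along the path gives an
-- exact identity (`angleSum_sub_angleSum`): Θ_Q − Θ_P is the Laplacian of u = log(r_Q/r_P) for a
-- symmetric positive conductance on the 1-skeleton. Equal angle sums therefore make u harmonic.
--
-- The inradius is at most half an edge and each edge lies on two triangles, so the conductances are
-- at most 1 (`conductance_le_one`). Recurrence of the simple walk gives finitely supported
-- functions equal to 1 at a vertex with arbitrarily small energy (`exists_energy_le`), and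
-- comparison carries these over to the new network. A positive harmonic function is then constant
-- (`eq_of_adj_of_harmonic`), hence so is a harmonic u bounded above. Thus if either ratio function
-- is bounded, both are constant.

namespace CirclePack

-- Variation of angles in a triple of tangent circles

open Real in
/-- The derivative of the angle, in a triple of mutually tangent circles with radii `a`, `b`, `c`,
at the center of the first one, when the logarithms of the radii have derivatives `x`, `y`, `z`. -/
theorem hasDerivAt_tangency_angle {a b c : ℝ → ℝ} {x y z t : ℝ}
    (ha : HasDerivAt a (a t * x) t) (hb : HasDerivAt b (b t * y) t)
    (hc : HasDerivAt c (c t * z) t) (a0 : 0 < a t) (b0 : 0 < b t) (c0 : 0 < c t) :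
    HasDerivAt (fun s => arccos (((a s + b s) ^ 2 + (a s + c s) ^ 2 - (b s + c s) ^ 2) /
        (2 * ((a s + b s) * (a s + c s)))))
      (√(a t * (b t * c t) / (a t + (b t + c t))) / (a t + b t) * (y - x) +
        √(a t * (b t * c t) / (a t + (b t + c t))) / (a t + c t) * (z - x)) t := by
  have hnum := (((ha.add hb).pow 2).add ((ha.add hc).pow 2)).sub ((hb.add hc).pow 2)
  have hden := ((ha.add hb).mul (ha.add hc)).const_mul 2
  have hX := hnum.div hden (ne_of_gt (show 0 < 2 * ((a t + b t) * (a t + c t)) by positivity))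
  set A := a t with hA
  set B := b t with hB
  set C := c t with hC
  have hab : 0 < A + B := by positivity
  have hac : 0 < A + C := by positivity
  have habc : 0 < A + (B + C) := by positivity
  -- The inradius: the semiperimeter is `A + B + C`, so by Heron the area is `κ * (A + B + C)`;
  -- `hsqrt` is then sine = twice the area over the product of the adjacent sides.
  set κ := √(A * (B * C) / (A + (B + C))) with hκ
  have hκ2 : κ ^ 2 * (A + (B + C)) = A * (B * C) := by
    rw [hκ, sq_sqrt (by positivity)]; field_simp
  have hκ0 : 0 < κ := sqrt_pos.2 (by positivity)
  have hlt1 : ((A + B) ^ 2 + (A + C) ^ 2 - (B + C) ^ 2) / (2 * ((A + B) * (A + C))) < 1 := by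
    rw [div_lt_one (by positivity)]; nlinarith [mul_pos b0 c0]
  have hgt1 : -1 < ((A + B) ^ 2 + (A + C) ^ 2 - (B + C) ^ 2) / (2 * ((A + B) * (A + C))) := by
    rw [lt_div_iff₀ (by positivity)]; nlinarith [mul_pos a0 habc]
  have hsqrt : √(1 - (((A + B) ^ 2 + (A + C) ^ 2 - (B + C) ^ 2) /
      (2 * ((A + B) * (A + C)))) ^ 2) = 2 * κ * (A + (B + C)) / ((A + B) * (A + C)) := by
    rw [sqrt_eq_iff_mul_self_eq_of_pos (by positivity)]
    field_simp
    linear_combination (16 * (A + (B + C))) * hκ2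
  have harc := (hasDerivAt_arccos (x := ((A + B) ^ 2 + (A + C) ^ 2 - (B + C) ^ 2) /
    (2 * ((A + B) * (A + C)))) hgt1.ne' hlt1.ne)
  rw [hsqrt] at harc
  refine (HasDerivAt.comp t harc hX).congr_deriv ?_
  simp only [Pi.add_apply, Pi.pow_apply, Pi.sub_apply, Pi.mul_apply, ← hA, ← hB, ← hC]
  field_simp
  norm_num
  linear_combination (-4 * ((A + C) * (y - x) + (A + B) * (z - x))) * hκ2

-- Log-linear interpolation and the conductance of one triangle

variable {V : Type*}

/-- The inradius of the triangle of centers of mutually tangent circles of radii `ρ x`, `x ∈ T`. -/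
noncomputable def inradius (ρ : V → ℝ) (T : Finset V) : ℝ := √((∏ x ∈ T, ρ x) / ∑ x ∈ T, ρ x)

/-- The log-linear interpolation between the labels `p` and `q`. -/
noncomputable def logInterp (p q : V → ℝ) (t : ℝ) (v : V) : ℝ :=
  p v * Real.exp (t * Real.log (q v / p v))

/-- The contribution of the triangle `T` to the conductance of the edge `v w`. -/
noncomputable def triangleConductance (p q : V → ℝ) (T : Finset V) (v w : V) : ℝ :=
  ∫ t in (0 : ℝ)..1, inradius (logInterp p q t) T / (logInterp p q t v + logInterp p q t w)

variable {p q : V → ℝ}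

theorem logInterp_pos (hp : ∀ v, 0 < p v) (t : ℝ) (v : V) : 0 < logInterp p q t v :=
  mul_pos (hp v) (Real.exp_pos _)

theorem logInterp_zero : logInterp p q 0 = p := by
  ext v; simp [logInterp]

theorem logInterp_one (hp : ∀ v, 0 < p v) (hq : ∀ v, 0 < q v) : logInterp p q 1 = q := by
  ext v
  have := hp v
  rw [logInterp, one_mul, Real.exp_log (div_pos (hq v) (hp v))]
  field_simp

theorem hasDerivAt_logInterp (t : ℝ) (v : V) :
    HasDerivAt (fun s => logInterp p q s v)
      (logInterp p q t v * Real.log (q v / p v)) t := by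
  have := (((hasDerivAt_id t).mul_const (Real.log (q v / p v))).exp).const_mul (p v)
  refine this.congr_deriv ?_
  simp [logInterp, mul_assoc]

theorem continuous_logInterp (v : V) : Continuous fun t => logInterp p q t v := by
  unfold logInterp; fun_prop

theorem continuous_triangleConductance_integrand (hp : ∀ v, 0 < p v) {T : Finset V}
    (hT : T.Nonempty) (v w : V) :
    Continuous fun t =>
      inradius (logInterp p q t) T / (logInterp p q t v + logInterp p q t w) := by
  refine Continuous.div (Continuous.sqrt (Continuous.div ?_ ?_ fun t => ?_)) ?_ fun t => ?_
  · exact continuous_finsetProd _ fun x _ => continuous_logInterp x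
  · exact continuous_finsetSum _ fun x _ => continuous_logInterp x
  · exact (Finset.sum_pos (fun x _ => logInterp_pos hp t x) hT).ne'
  · exact (continuous_logInterp v).add (continuous_logInterp w)
  · exact (add_pos (logInterp_pos hp t v) (logInterp_pos hp t w)).ne'

theorem triangleConductance_comm (T : Finset V) (v w : V) :
    triangleConductance p q T v w = triangleConductance p q T w v := by
  simp only [triangleConductance, add_comm]

theorem inradius_pos {ρ : V → ℝ} (hρ : ∀ v, 0 < ρ v) {T : Finset V} (hT : T.Nonempty) :
    0 < inradius ρ T :=
  Real.sqrt_pos.2 (div_pos (Finset.prod_pos fun x _ => hρ x) (Finset.sum_pos (fun x _ => hρ x) hT))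

theorem triangleConductance_pos (hp : ∀ v, 0 < p v) {T : Finset V} (hT : T.Nonempty) (v w : V) :
    0 < triangleConductance p q T v w :=
  intervalIntegral.intervalIntegral_pos_of_pos
    ((continuous_triangleConductance_integrand hp hT v w).intervalIntegrable _ _)
    (fun t => div_pos (inradius_pos (logInterp_pos hp t) hT)
      (add_pos (logInterp_pos hp t v) (logInterp_pos hp t w))) one_pos

variable [DecidableEq V]

theorem exists_eq_insert_insert_singleton {T : Finset V} (hT : T.card = 3) {v w : V} (hv : v ∈ T)
    (hw : w ∈ T) (hvw : v ≠ w) : ∃ z, z ≠ v ∧ z ≠ w ∧ T = {v, w, z} := by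
  have h1 : ((T.erase v).erase w).card = 1 := by
    rw [Finset.card_erase_of_mem (Finset.mem_erase.2 ⟨hvw.symm, hw⟩), Finset.card_erase_of_mem hv,
      hT]
  obtain ⟨z, hz⟩ := Finset.card_eq_one.1 h1
  have hz' : z ∈ (T.erase v).erase w := by simp [hz]
  simp only [Finset.mem_erase] at hz'
  refine ⟨z, hz'.2.1, hz'.1, ?_⟩
  rw [← hz, Finset.insert_erase (Finset.mem_erase.2 ⟨hvw.symm, hw⟩), Finset.insert_erase hv]

/-- Since the third radius is less than the sum of all three, the squared inradius is at most `ρ v *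
ρ w`; then AM-GM. -/
theorem inradius_le_half {ρ : V → ℝ} (hρ : ∀ v, 0 < ρ v) {T : Finset V} (hT : T.card = 3) {v w : V}
    (hv : v ∈ T) (hw : w ∈ T) (hvw : v ≠ w) : inradius ρ T ≤ (ρ v + ρ w) / 2 := by
  obtain ⟨z, hzv, hzw, rfl⟩ := exists_eq_insert_insert_singleton hT hv hw hvw
  have h1 := hρ v
  have h2 := hρ w
  have h3 := hρ z
  refine Real.sqrt_le_iff.2 ⟨by positivity, ?_⟩
  rw [Finset.prod_insert (by simp [hvw, hzv.symm]), Finset.prod_pair hzw.symm,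
    Finset.sum_insert (by simp [hvw, hzv.symm]), Finset.sum_pair hzw.symm,
    div_le_iff₀ (by positivity)]
  have h4 : ρ v * ρ w ≤ ((ρ v + ρ w) / 2) ^ 2 := by nlinarith [sq_nonneg (ρ v - ρ w)]
  calc ρ v * (ρ w * ρ z) = ρ v * ρ w * ρ z := by ring
    _ ≤ ((ρ v + ρ w) / 2) ^ 2 * (ρ v + (ρ w + ρ z)) := by gcongr; linarith

theorem triangleConductance_le_half (hp : ∀ v, 0 < p v) {T : Finset V} (hT : T.card = 3) {v w : V}
    (hv : v ∈ T) (hw : w ∈ T) (hvw : v ≠ w) : triangleConductance p q T v w ≤ 1 / 2 := by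
  have hc := continuous_triangleConductance_integrand (q := q) hp ⟨v, hv⟩ v w
  calc triangleConductance p q T v w ≤ ∫ _ in (0 : ℝ)..1, (1 / 2 : ℝ) := by
        refine intervalIntegral.integral_mono zero_le_one (hc.intervalIntegrable _ _)
          intervalIntegrable_const fun t => ?_
        have h1 := logInterp_pos (q := q) hp t v
        have h2 := logInterp_pos (q := q) hp t w
        rw [div_le_iff₀ (by positivity)]
        linarith [inradius_le_half (logInterp_pos (q := q) hp t) hT hv hw hvw]
    _ = 1 / 2 := by simp

/-- The fundamental theorem of calculus along `logInterp`. The logarithmic derivatives of the radii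
do not depend on `t`, so they leave the integral and the infinitesimal formula becomes an exact one.
-/
theorem angle_sub_angle (hp : ∀ v, 0 < p v) (hq : ∀ v, 0 < q v) {T : Finset V} (hT : T.card = 3)
    {v : V} (hv : v ∈ T) :
    angle q v T - angle p v T = ∑ w ∈ T.erase v, triangleConductance p q T v w *
      (Real.log (q w / p w) - Real.log (q v / p v)) := by
  obtain ⟨w, hw⟩ : (T.erase v).Nonempty :=
    Finset.card_pos.1 (by rw [Finset.card_erase_of_mem hv, hT]; norm_num)
  have hvw := (Finset.mem_erase.1 hw).1.symm
  obtain ⟨z, hzv, hzw, hTeq⟩ :=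
    exists_eq_insert_insert_singleton hT hv (Finset.mem_erase.1 hw).2 hvw
  have herase : T.erase v = {w, z} := by
    rw [hTeq, Finset.erase_insert (by simp [hvw, hzv.symm])]
  have hderiv (t : ℝ) : HasDerivAt (fun s => angle (logInterp p q s) v T)
      (inradius (logInterp p q t) T / (logInterp p q t v + logInterp p q t w) *
          (Real.log (q w / p w) - Real.log (q v / p v)) +
        inradius (logInterp p q t) T / (logInterp p q t v + logInterp p q t z) *
          (Real.log (q z / p z) - Real.log (q v / p v))) t := by
    have h := hasDerivAt_tangency_angle (hasDerivAt_logInterp (p := p) (q := q) t v)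
      (hasDerivAt_logInterp (p := p) (q := q) t w)
      (hasDerivAt_logInterp (p := p) (q := q) t z) (logInterp_pos hp t v)
      (logInterp_pos hp t w) (logInterp_pos hp t z)
    have hin : inradius (logInterp p q t) T = √(logInterp p q t v *
        (logInterp p q t w * logInterp p q t z) /
        (logInterp p q t v + (logInterp p q t w + logInterp p q t z))) := by
      rw [inradius, hTeq, Finset.prod_insert (by simp [hvw, hzv.symm]), Finset.prod_pair hzw.symm,
        Finset.sum_insert (by simp [hvw, hzv.symm]), Finset.sum_pair hzw.symm]
    have hang : (fun s => angle (logInterp p q s) v T) = fun s =>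
        Real.arccos (((logInterp p q s v + logInterp p q s w) ^ 2 +
          (logInterp p q s v + logInterp p q s z) ^ 2 -
          (logInterp p q s w + logInterp p q s z) ^ 2) /
          (2 * ((logInterp p q s v + logInterp p q s w) *
            (logInterp p q s v + logInterp p q s z)))) := by
      funext s
      simp only [angle, herase, Finset.sum_pair hzw.symm, Finset.prod_pair hzw.symm]
    rw [hin, hang]
    exact h
  have hne : T.Nonempty := ⟨v, hv⟩
  have hw := ((continuous_triangleConductance_integrand (q := q) hp hne v w).intervalIntegrable
    (μ := volume) 0 1).mul_const (Real.log (q w / p w) - Real.log (q v / p v))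
  have hz := ((continuous_triangleConductance_integrand (q := q) hp hne v z).intervalIntegrable
    (μ := volume) 0 1).mul_const (Real.log (q z / p z) - Real.log (q v / p v))
  have hint := intervalIntegral.integral_eq_sub_of_hasDerivAt (fun t _ => hderiv t) (hw.add hz)
  rw [intervalIntegral.integral_add hw hz, intervalIntegral.integral_mul_const,
    intervalIntegral.integral_mul_const, logInterp_one hp hq, logInterp_zero] at hint
  rw [← hint, herase, Finset.sum_pair hzw.symm]
  rfl

-- Recurrence in terms of transition probabilities

section Walk

theorem cylinder_update_subset {V : Type*} (n : ℕ) (x : ℕ → V) (y : V) :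
    {ω : ℕ → V | ∀ i ≤ n + 1, ω i = Function.update x (n + 1) y i} ⊆
      {ω | ∀ i ≤ n, ω i = x i} := fun ω hω i hi => by
  rw [hω i (by omega), Function.update_of_ne (by omega)]

theorem measurableSet_cylinder {V : Type*} [MeasurableSpace V]
    [MeasurableSingletonClass V] (n : ℕ) (x : ℕ → V) :
    MeasurableSet {ω : ℕ → V | ∀ i ≤ n, ω i = x i} := by
  simp only [Set.ofPred_forall]
  exact MeasurableSet.iInter fun i => MeasurableSet.iInter fun _ =>
    (measurableSet_singleton (x i)).preimage (measurable_pi_apply i)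

variable {V : Type*} [DecidableEq V]

theorem measureReal_cylinder_update {G : SimpleGraph V} [MeasurableSpace V] {v : V}
    {μ : Measure (ℕ → V)} (hμ : IsWalkLaw (simpleWalk G) v μ) (n : ℕ) (x : ℕ → V)
    (y : V) :
    μ.real {ω | ∀ i ≤ n + 1, ω i = Function.update x (n + 1) y i} =
      μ.real {ω | ∀ i ≤ n, ω i = x i} * simpleWalk G (x n) y := by
  have h (i : ℕ) (hi : i ≤ n) : Function.update x (n + 1) y i = x i :=
    Function.update_of_ne (by omega) _ _
  rw [hμ.2, hμ.2, Finset.prod_range_succ, ← mul_assoc, h 0 n.zero_le, h n le_rfl,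
    Function.update_self]
  congr 2
  refine Finset.prod_congr rfl fun i hi => ?_
  rw [Finset.mem_range] at hi
  rw [h i hi.le, h (i + 1) hi]

variable (G : SimpleGraph V) [G.LocallyFinite]

/-- The probability that the simple random walk on `G` started at `x` is at `o` at time `k`. -/
noncomputable def transition (o : V) : ℕ → V → ℝ
  | 0 => Pi.single o 1
  -- Conditioning on the first step, with the target `o` fixed, makes Laplacians of sums over `k`
  -- telescope.
  | k + 1 => fun x => (∑ y ∈ G.neighborFinset x, transition o k y) / G.degree x

variable {G}

theorem transition_nonneg (o : V) (k : ℕ) (x : V) : 0 ≤ transition G o k x := by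
  induction k generalizing x with
  | zero =>
    by_cases h : x = o
    · subst h; simp [transition]
    · simp [transition, h]
  | succ k ih => exact div_nonneg (Finset.sum_nonneg fun y _ => ih y) (Nat.cast_nonneg _)

theorem exists_adj_of_transition_succ_ne_zero {o x : V} {k : ℕ}
    (h : transition G o (k + 1) x ≠ 0) : ∃ y, G.Adj x y ∧ transition G o k y ≠ 0 := by
  rw [transition, Ne, div_eq_zero_iff, not_or] at h
  obtain ⟨y, hy, hy0⟩ := Finset.exists_ne_zero_of_sum_ne_zero h.1
  exact ⟨y, by simpa using hy, hy0⟩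

theorem finite_support_transition (o : V) (k : ℕ) :
    (Function.support (transition G o k)).Finite := by
  induction k with
  | zero =>
    refine (Set.finite_singleton o).subset fun x hx => ?_
    by_contra h
    exact hx (by simp [transition, show x ≠ o from h])
  | succ k ih =>
    refine (ih.biUnion fun y _ => (G.neighborFinset y).finite_toSet).subset fun x hx => ?_
    obtain ⟨y, hxy, hy⟩ := exists_adj_of_transition_succ_ne_zero hx
    exact Set.mem_biUnion hy (by simpa using hxy.symm)

theorem simpleWalk_eq (x y : V) :
    simpleWalk G x y = if y ∈ G.neighborFinset x then 1 / (G.degree x : ℝ) else 0 := by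
  rw [simpleWalk, Set.ncard_eq_toFinset_card', ← SimpleGraph.neighborFinset,
    SimpleGraph.card_neighborFinset_eq_degree]
  by_cases h : G.Adj x y
  · rw [if_pos h, if_pos ((G.mem_neighborFinset x y).2 h)]
  · rw [if_neg h, if_neg fun h' => h ((G.mem_neighborFinset x y).1 h')]

section Law

variable [MeasurableSpace V] [MeasurableSingletonClass V] {v : V} {μ : Measure (ℕ → V)}

/-- Almost surely, the walk moves to a neighbor. -/
theorem measureReal_cylinder_diff (hμ : IsWalkLaw (simpleWalk G) v μ)
    (hG : ∀ x, 0 < G.degree x) (n : ℕ) (x : ℕ → V) :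
    μ.real ({ω | ∀ i ≤ n, ω i = x i} \ ⋃ y ∈ G.neighborFinset (x n),
      {ω | ∀ i ≤ n + 1, ω i = Function.update x (n + 1) y i}) = 0 := by
  have := hμ.1
  have hd : (G.degree (x n) : ℝ) ≠ 0 := by exact_mod_cast (hG (x n)).ne'
  rw [measureReal_sdiff (Set.iUnion₂_subset fun y _ => cylinder_update_subset n x y)
      (Finset.measurableSet_biUnion _ fun y _ => measurableSet_cylinder _ _),
    measureReal_biUnion_finset ?_ fun y _ => measurableSet_cylinder _ _]
  · simp_rw [measureReal_cylinder_update hμ]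
    rw [← Finset.mul_sum, Finset.sum_congr rfl fun y hy => by rw [simpleWalk_eq, if_pos hy],
      Finset.sum_const, SimpleGraph.card_neighborFinset_eq_degree, nsmul_eq_mul,
      mul_one_div_cancel hd, mul_one, sub_self]
  · intro y _ z _ hyz
    refine Set.disjoint_left.2 fun ω hy hz => hyz ?_
    have h1 := hy (n + 1) le_rfl
    have h2 := hz (n + 1) le_rfl
    simp only [Function.update_self] at h1 h2
    exact h1.symm.trans h2

/-- The Markov property at time `n`, by splitting the cylinder according to the next vertex. An
upper bound is enough for what follows and needs only subadditivity. -/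
theorem measureReal_cylinder_inter_le (hμ : IsWalkLaw (simpleWalk G) v μ)
    (hG : ∀ x, 0 < G.degree x) (o : V) (k n : ℕ) (x : ℕ → V) :
    μ.real ({ω | ∀ i ≤ n, ω i = x i} ∩ {ω | ω (n + k) = o}) ≤
      μ.real {ω | ∀ i ≤ n, ω i = x i} * transition G o k (x n) := by
  have := hμ.1
  induction k generalizing n x with
  | zero =>
    by_cases h : x n = o
    · simpa [transition, h] using measureReal_mono Set.inter_subset_left
    · have : {ω : ℕ → V | ∀ i ≤ n, ω i = x i} ∩ {ω | ω (n + 0) = o} = ∅ :=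
        Set.eq_empty_of_forall_notMem fun ω hω => h ((hω.1 n le_rfl).symm.trans hω.2)
      rw [this]
      simp [transition, h]
  | succ k ih =>
    have hsub : {ω : ℕ → V | ∀ i ≤ n, ω i = x i} ∩ {ω | ω (n + (k + 1)) = o} ⊆
        ({ω | ∀ i ≤ n, ω i = x i} \ ⋃ y ∈ G.neighborFinset (x n),
          {ω | ∀ i ≤ n + 1, ω i = Function.update x (n + 1) y i}) ∪
        ⋃ y ∈ G.neighborFinset (x n),
          ({ω | ∀ i ≤ n + 1, ω i = Function.update x (n + 1) y i} ∩
            {ω | ω (n + 1 + k) = o}) := by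
      rintro ω ⟨h1, h2⟩
      by_cases h : ω ∈ ⋃ y ∈ G.neighborFinset (x n),
          {ω : ℕ → V | ∀ i ≤ n + 1, ω i = Function.update x (n + 1) y i}
      · obtain ⟨y, hy, hω⟩ := Set.mem_iUnion₂.1 h
        refine Or.inr (Set.mem_iUnion₂.2 ⟨y, hy, hω, ?_⟩)
        rw [Set.mem_ofPred_eq] at h2 ⊢
        rw [← h2]
        congr 1
        omega
      · exact Or.inl ⟨h1, h⟩
    refine (measureReal_mono hsub).trans ((measureReal_union_le _ _).trans ?_)
    rw [measureReal_cylinder_diff hμ hG, zero_add]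
    refine (measureReal_biUnion_finset_le _ _).trans
      ((Finset.sum_le_sum fun y _ => ih (n + 1) (Function.update x (n + 1) y)).trans_eq ?_)
    simp_rw [measureReal_cylinder_update hμ, Function.update_self]
    simp only [transition]
    rw [Finset.sum_div, Finset.mul_sum]
    refine Finset.sum_congr rfl fun y hy => ?_
    rw [simpleWalk_eq, if_pos hy]
    ring

theorem measureReal_le_transition (hμ : IsWalkLaw (simpleWalk G) v μ)
    (hG : ∀ x, 0 < G.degree x) (o : V) (k : ℕ) :
    μ.real {ω | ω k = o} ≤ transition G o k v := by
  have := hμ.1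
  have h0 : μ.real {ω | ∀ i ≤ 0, ω i = (fun _ : ℕ => v) i} = 1 := by
    rw [hμ.2]; simp
  have hcompl : μ.real {ω | ∀ i ≤ 0, ω i = (fun _ : ℕ => v) i}ᶜ = 0 := by
    rw [measureReal_compl (measurableSet_cylinder _ _), h0, probReal_univ, sub_self]
  have hle := measureReal_cylinder_inter_le hμ hG o k 0 fun _ => v
  rw [h0, one_mul, zero_add] at hle
  calc μ.real {ω | ω k = o}
      ≤ μ.real ({ω | ∀ i ≤ 0, ω i = (fun _ : ℕ => v) i} ∩ {ω | ω k = o} ∪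
          {ω | ∀ i ≤ 0, ω i = (fun _ : ℕ => v) i}ᶜ) :=
        measureReal_mono fun ω hω => by
          by_cases h : ω ∈ {ω : ℕ → V | ∀ i ≤ 0, ω i = (fun _ : ℕ => v) i}
          · exact Or.inl ⟨h, hω⟩
          · exact Or.inr h
    _ ≤ _ := measureReal_union_le _ _
    _ ≤ transition G o k v := by rw [hcompl, add_zero]; exact hle

end Law

/-- This takes the place of connectedness of the graph: a walk that almost surely reaches `o` does
so with positive probability at some fixed time. -/
theorem exists_transition_ne_zero (hrec : IsRecurrentGraph G) (hG : ∀ x, 0 < G.degree x)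
    (o v : V) : ∃ k, transition G o k v ≠ 0 := by
  let _ : MeasurableSpace V := ⊤
  obtain ⟨μ, hμ, hae⟩ := hrec v
  have := hμ.1
  by_contra! h
  have hnever : ∀ᵐ ω ∂μ, ∀ k, ω k ≠ o := ae_all_iff.2 fun k => by
    have h1 : μ.real {ω | ω k = o} = 0 :=
      le_antisymm ((measureReal_le_transition hμ hG o k).trans (h k).le) measureReal_nonneg
    rw [measureReal_eq_zero_iff] at h1
    exact measure_eq_zero_iff_ae_notMem.1 h1
  obtain ⟨ω, h1, h2⟩ := (hae.and hnever).exists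
  obtain ⟨k, hk⟩ := (h1 o).exists
  exact h2 k hk

/-- Borel–Cantelli: summable return probabilities would allow only finitely many returns. -/
theorem not_summable_transition (hrec : IsRecurrentGraph G) (hG : ∀ x, 0 < G.degree x)
    (o : V) : ¬ Summable fun k => transition G o k o := by
  let _ : MeasurableSpace V := ⊤
  obtain ⟨μ, hμ, hae⟩ := hrec o
  have := hμ.1
  intro hs
  have hfin : ∑' k, μ {ω | ω k = o} ≠ ⊤ := by
    refine ne_top_of_le_ne_top hs.tsum_ofReal_ne_top (ENNReal.tsum_le_tsum fun k => ?_)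
    rw [← ofReal_measureReal]
    exact ENNReal.ofReal_le_ofReal (measureReal_le_transition hμ hG o k)
  obtain ⟨ω, h1, h2⟩ := (hae.and (ae_eventually_notMem hfin)).exists
  obtain ⟨k, hk, hk'⟩ := ((h1 o).and_eventually h2).exists
  exact hk' hk

end Walk

-- Zero capacity and the Liouville property

section Network

variable {V : Type*}

/-- Summation by parts (discrete Green's formula); the 2 appears because each edge is counted in
both directions. -/
theorem sum_sum_mul_sub_mul_sub (B : Finset V) {c : V → V → ℝ} (hc : ∀ x y, c x y = c y x)
    (w g : V → ℝ) :
    ∑ x ∈ B, ∑ y ∈ B, c x y * ((w x - w y) * (g x - g y)) =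
      2 * ∑ x ∈ B, g x * ∑ y ∈ B, c x y * (w x - w y) := by
  have h1 : ∑ x ∈ B, ∑ y ∈ B, c x y * ((w x - w y) * (g x - g y)) =
      ∑ x ∈ B, ∑ y ∈ B, g x * (c x y * (w x - w y)) -
        ∑ x ∈ B, ∑ y ∈ B, g y * (c x y * (w x - w y)) := by
    simp_rw [← Finset.sum_sub_distrib]
    exact Finset.sum_congr rfl fun x _ => Finset.sum_congr rfl fun y _ => by ring
  have h2 : ∑ x ∈ B, ∑ y ∈ B, g y * (c x y * (w x - w y)) =
      -∑ x ∈ B, ∑ y ∈ B, g x * (c x y * (w x - w y)) := by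
    rw [Finset.sum_comm]
    simp_rw [← Finset.sum_neg_distrib]
    exact Finset.sum_congr rfl fun x _ => Finset.sum_congr rfl fun y _ => by rw [hc y x]; ring
  rw [h1, h2]
  simp_rw [Finset.mul_sum]
  rw [sub_neg_eq_add, ← two_mul, Finset.mul_sum]
  simp_rw [Finset.mul_sum]

variable {G : SimpleGraph V} [G.LocallyFinite]

theorem sum_eq_sum_neighborFinset {B : Finset V} {x : V} (hB : G.neighborFinset x ⊆ B)
    {F : V → ℝ} (hF : ∀ y, ¬ G.Adj x y → F y = 0) :
    ∑ y ∈ B, F y = ∑ y ∈ G.neighborFinset x, F y :=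
  (Finset.sum_subset hB fun y _ hy => hF y (by simpa using hy)).symm

variable [DecidableEq V]

/-- The closed neighborhood of a finite set. -/
def closedNeighborhood (G : SimpleGraph V) [G.LocallyFinite] (S : Finset V) : Finset V :=
  S ∪ S.biUnion fun x => G.neighborFinset x

theorem neighborFinset_subset_closedNeighborhood {S : Finset V} {x : V} (hx : x ∈ S) :
    G.neighborFinset x ⊆ closedNeighborhood G S :=
  (Finset.subset_biUnion_of_mem (fun x => G.neighborFinset x) hx).trans Finset.subset_union_right

open Classical in
/-- If the walk is recurrent, a vertex has zero capacity. -/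
theorem exists_energy_le {o : V} (ho : ¬ Summable fun k => transition G o k o)
    (hG : ∀ x, 0 < G.degree x) {ε : ℝ} (hε : 0 < ε) :
    ∃ f : V → ℝ, (Function.support f).Finite ∧ f o = 1 ∧ ∀ B : Finset V,
      ∑ x ∈ B, ∑ y ∈ B, (if G.Adj x y then 1 else 0) * (f x - f y) ^ 2 ≤ ε := by
  rw [not_summable_iff_tendsto_nat_atTop_of_nonneg fun k => transition_nonneg o k o] at ho
  obtain ⟨n, hn, hn0⟩ := ((ho.eventually_ge_atTop (2 * G.degree o / ε)).and
    (ho.eventually_gt_atTop 0)).exists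
  -- The Green function truncated at time `n`. Its energy is at most `2 * G.degree o * g o`, so `g /
  -- g o` has energy at most `2 * G.degree o / g o`, which is at most `ε` by the choice of `n`.
  set g : V → ℝ := fun x => ∑ k ∈ Finset.range n, transition G o k x with hg
  have hg_nonneg (x : V) : 0 ≤ g x := Finset.sum_nonneg fun k _ => transition_nonneg o k x
  have hg_fin : (Function.support g).Finite := by
    refine ((Finset.range n).finite_toSet.biUnion fun k _ =>
      finite_support_transition (G := G) o k).subset fun x hx => ?_
    obtain ⟨k, hk, hk0⟩ := Finset.exists_ne_zero_of_sum_ne_zero hx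
    exact Set.mem_biUnion hk hk0
  have hlap (x : V) : ∑ y ∈ G.neighborFinset x, (g x - g y) =
      G.degree x * (transition G o 0 x - transition G o n x) := by
    have hd : (G.degree x : ℝ) ≠ 0 := by exact_mod_cast (hG x).ne'
    have h1 : ∑ y ∈ G.neighborFinset x, g y =
        G.degree x * ∑ k ∈ Finset.range n, transition G o (k + 1) x := by
      rw [Finset.sum_comm, Finset.mul_sum]
      refine Finset.sum_congr rfl fun k _ => ?_
      rw [transition]
      field_simp
    rw [Finset.sum_sub_distrib, h1, Finset.sum_const, SimpleGraph.card_neighborFinset_eq_degree,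
      nsmul_eq_mul, ← mul_sub, ← Finset.sum_range_sub' (fun k => transition G o k x),
      Finset.sum_sub_distrib]
  have henergy (B : Finset V) :
      ∑ x ∈ B, ∑ y ∈ B, (if G.Adj x y then 1 else 0) * (g x - g y) ^ 2 ≤
        2 * (G.degree o * g o) := by
    set S := insert o hg_fin.toFinset
    -- Enlarging `B` only increases the energy, and `B'` contains all neighbors of `S`, so the inner
    -- sums over `B'` become full Laplacians there.
    set B' := B ∪ closedNeighborhood G S with hB'
    have hSB : S ⊆ B' := Finset.subset_union_left.trans Finset.subset_union_right
    calc ∑ x ∈ B, ∑ y ∈ B, (if G.Adj x y then (1 : ℝ) else 0) * (g x - g y) ^ 2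
        ≤ ∑ x ∈ B', ∑ y ∈ B', (if G.Adj x y then 1 else 0) * (g x - g y) ^ 2 := by
          have h0 (x y : V) : 0 ≤ (if G.Adj x y then (1 : ℝ) else 0) * (g x - g y) ^ 2 := by
            positivity
          exact (Finset.sum_le_sum fun x _ => Finset.sum_le_sum_of_subset_of_nonneg
            Finset.subset_union_left fun y _ _ => h0 x y).trans
            (Finset.sum_le_sum_of_subset_of_nonneg Finset.subset_union_left
              fun x _ _ => Finset.sum_nonneg fun y _ => h0 x y)
      _ = 2 * ∑ x ∈ B', g x * ∑ y ∈ B', (if G.Adj x y then 1 else 0) * (g x - g y) := by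
          rw [← sum_sum_mul_sub_mul_sub B' fun x y => by simp only [G.adj_comm]]
          simp_rw [sq]
      _ ≤ 2 * ∑ x ∈ B', if x = o then G.degree o * g o else 0 := by
          gcongr with x hx
          by_cases hxS : x ∈ S
          · rw [sum_eq_sum_neighborFinset ((neighborFinset_subset_closedNeighborhood hxS).trans
              Finset.subset_union_right) fun y hy => by simp [hy],
              Finset.sum_congr rfl fun y hy => by
                rw [if_pos (by simpa using hy), one_mul], hlap]
            have h1 : 0 ≤ g x * (G.degree x * transition G o n x) :=
              mul_nonneg (hg_nonneg x) (mul_nonneg (Nat.cast_nonneg _) (transition_nonneg o n x))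
            split_ifs with hxo
            · subst hxo
              simp only [transition, Pi.single_eq_same]
              linarith
            · simp only [transition, Pi.single_eq_of_ne hxo]
              linarith
          · have hx0 : g x = 0 := by
              by_contra h
              exact hxS (Finset.mem_insert_of_mem (hg_fin.mem_toFinset.2 h))
            rw [hx0, zero_mul, if_neg]
            rintro rfl
            exact hxS (Finset.mem_insert_self _ _)
      _ = 2 * (G.degree o * g o) := by
          rw [Finset.sum_ite_eq', if_pos (hSB (Finset.mem_insert_self _ _))]
  have hgo : 0 < g o := hn0
  refine ⟨fun x => g x / g o, hg_fin.subset fun x hx h => hx (by simp [h]), div_self hgo.ne',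
    fun B => ?_⟩
  have hscale : ∑ x ∈ B, ∑ y ∈ B, (if G.Adj x y then (1 : ℝ) else 0) *
      (g x / g o - g y / g o) ^ 2 =
      (∑ x ∈ B, ∑ y ∈ B, (if G.Adj x y then 1 else 0) * (g x - g y) ^ 2) / g o ^ 2 := by
    simp_rw [Finset.sum_div]
    refine Finset.sum_congr rfl fun x _ => Finset.sum_congr rfl fun y _ => ?_
    rw [← sub_div, div_pow, mul_div_assoc]
  rw [hscale, div_le_iff₀ (by positivity)]
  refine (henergy B).trans ?_
  have h2 : 2 * (G.degree o : ℝ) ≤ g o * ε := (div_le_iff₀ hε).1 hn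
  nlinarith

open Classical in
/-- On a network with conductances at most `1` on a graph in which the vertex `o` has zero
capacity, a positive harmonic function takes the same value at `o` and at its neighbors. -/
theorem eq_of_adj_of_harmonic {o : V} (ho : ¬ Summable fun k => transition G o k o)
    (hG : ∀ x, 0 < G.degree x) {c : V → V → ℝ} (hsymm : ∀ x y, c x y = c y x)
    (hpos : ∀ x y, G.Adj x y → 0 < c x y) (hzero : ∀ x y, ¬ G.Adj x y → c x y = 0)
    (hle : ∀ x y, c x y ≤ 1) {w : V → ℝ} (hw : ∀ x, 0 < w x)
    (hharm : ∀ x, ∑ y ∈ G.neighborFinset x, c x y * (w x - w y) = 0) {z : V} (hz : G.Adj o z) :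
    w z = w o := by
  have hc0 (x y : V) : 0 ≤ c x y := by
    by_cases h : G.Adj x y
    exacts [(hpos x y h).le, (hzero x y h).ge]
  have hbound (ε : ℝ) (hε : 0 < ε) : c o z * (w z - w o) ^ 2 ≤
      2 * (w o * w z + w o ^ 2) * ε := by
    obtain ⟨f, hf, hfo, hfε⟩ := exists_energy_le ho hG hε
    set B := insert o (insert z (closedNeighborhood G hf.toFinset)) with hB
    have hoB : o ∈ B := by simp [hB]
    have hzB : z ∈ B := by simp [hB]
    -- Test the harmonicity of `w` against `f ^ 2 / w`. Edge by edge, `(w x - w y) * (f x ^ 2 / w x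
    -- - f y ^ 2 / w y)` is the right-hand term minus the left-hand one.
    have hcaccioppoli : ∑ x ∈ B, ∑ y ∈ B, c x y * ((f x * w y - f y * w x) ^ 2 / (w x * w y)) =
        ∑ x ∈ B, ∑ y ∈ B, c x y * (f x - f y) ^ 2 := by
      have h1 := sum_sum_mul_sub_mul_sub B hsymm w fun x => f x ^ 2 / w x
      have h2 : ∑ x ∈ B, f x ^ 2 / w x * ∑ y ∈ B, c x y * (w x - w y) = 0 := by
        refine Finset.sum_eq_zero fun x _ => ?_
        by_cases hx : f x = 0
        · simp [hx]
        · rw [sum_eq_sum_neighborFinset ((neighborFinset_subset_closedNeighborhood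
            (hf.mem_toFinset.2 hx)).trans ((Finset.subset_insert _ _).trans
            (Finset.subset_insert _ _))) fun y hy => by rw [hzero x y hy, zero_mul], hharm,
            mul_zero]
      rw [h2, mul_zero] at h1
      rw [eq_comm, ← sub_eq_zero, ← h1]
      simp_rw [← Finset.sum_sub_distrib]
      refine Finset.sum_congr rfl fun x _ => Finset.sum_congr rfl fun y _ => ?_
      have hx := (hw x).ne'
      have hy := (hw y).ne'
      field_simp
      ring
    -- Rayleigh comparison with unit conductances; this is where `c ≤ 1` enters.
    have henergy : ∑ x ∈ B, ∑ y ∈ B, c x y * (f x - f y) ^ 2 ≤ ε := by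
      refine le_trans (Finset.sum_le_sum fun x _ => Finset.sum_le_sum fun y _ => ?_) (hfε B)
      gcongr
      split_ifs with h
      exacts [hle x y, (hzero x y h).le]
    have hterm {F : V → V → ℝ} (hF : ∀ x y, 0 ≤ F x y) (hFε : ∑ x ∈ B, ∑ y ∈ B, F x y ≤ ε) :
        F o z ≤ ε :=
      (Finset.single_le_sum (f := fun y => F o y) (fun y _ => hF o y) hzB).trans
        ((Finset.single_le_sum (f := fun x => ∑ y ∈ B, F x y)
          (fun x _ => Finset.sum_nonneg fun y _ => hF x y) hoB).trans hFε)
    have h1 := hterm (F := fun x y => c x y * (f x - f y) ^ 2)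
      (fun x y => mul_nonneg (hc0 x y) (sq_nonneg _)) henergy
    have h2 := hterm (F := fun x y => c x y * ((f x * w y - f y * w x) ^ 2 / (w x * w y)))
      (fun x y => mul_nonneg (hc0 x y) (div_nonneg (sq_nonneg _)
        (mul_pos (hw x) (hw y)).le)) (hcaccioppoli.trans_le henergy)
    simp only [hfo, one_mul] at h1 h2
    rw [← mul_div_assoc, div_le_iff₀ (mul_pos (hw o) (hw z))] at h2
    have h3 : c o z * (1 - f z) ^ 2 * w o ^ 2 ≤ ε * w o ^ 2 := by gcongr
    -- Write `w z - w o` as `(w z - f z * w o) - (1 - f z) * w o`; `h2` controls the first part and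
    -- `h3` the second.
    calc c o z * (w z - w o) ^ 2
        ≤ c o z * (2 * (w z - f z * w o) ^ 2 + 2 * ((1 - f z) ^ 2 * w o ^ 2)) := by
          gcongr
          · exact hc0 o z
          · nlinarith [sq_nonneg ((w z - f z * w o) + (1 - f z) * w o)]
      _ ≤ 2 * (w o * w z + w o ^ 2) * ε := by linarith
  have hK : 0 < 2 * (w o * w z + w o ^ 2) := by
    have := hw o
    have := hw z
    positivity
  have hle0 : c o z * (w z - w o) ^ 2 ≤ 0 := le_of_forall_pos_le_add fun δ hδ => by
    have := hbound (δ / (2 * (w o * w z + w o ^ 2))) (by positivity)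
    rwa [mul_div_cancel₀ _ hK.ne', ← zero_add δ] at this
  have hsq : (w z - w o) ^ 2 = 0 :=
    le_antisymm (nonpos_of_mul_nonpos_right hle0 (hpos o z hz)) (sq_nonneg _)
  exact sub_eq_zero.1 (pow_eq_zero_iff two_ne_zero |>.1 hsq)

/-- The Liouville property of recurrent networks. -/
theorem eq_of_harmonic_of_bddAbove (hrec : IsRecurrentGraph G)
    (hG : ∀ x, 0 < G.degree x) {c : V → V → ℝ} (hsymm : ∀ x y, c x y = c y x)
    (hpos : ∀ x y, G.Adj x y → 0 < c x y) (hzero : ∀ x y, ¬ G.Adj x y → c x y = 0)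
    (hle : ∀ x y, c x y ≤ 1) {u : V → ℝ} (hu : BddAbove (Set.range u))
    (hharm : ∀ x, ∑ y ∈ G.neighborFinset x, c x y * (u y - u x) = 0) (x o : V) :
    u x = u o := by
  obtain ⟨M, hM⟩ := hu
  have hadj {a b : V} (hab : G.Adj a b) : u b = u a := by
    -- The added 1 keeps the function strictly positive even where `u` attains `M`.
    have := eq_of_adj_of_harmonic (w := fun x => M + 1 - u x)
      (not_summable_transition hrec hG a) hG hsymm hpos hzero hle
      (fun x => by linarith [hM (Set.mem_range_self x)])
      (fun x => by rw [← hharm x]; exact Finset.sum_congr rfl fun y _ => by ring) hab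
    linarith
  obtain ⟨k, hk⟩ := exists_transition_ne_zero hrec hG o x
  induction k generalizing x with
  | zero =>
    by_contra h
    exact hk (by rw [transition, Pi.single_eq_of_ne]; rintro rfl; exact h rfl)
  | succ k ih =>
    obtain ⟨y, hxy, hy⟩ := exists_adj_of_transition_succ_ne_zero hk
    rw [← ih y hy, hadj hxy]

end Network

-- The network on the 1-skeleton of a triangulation

variable {V : Type*} {K : PlaneTriangulation V}

namespace PlaneTriangulation

theorem mem_star {v : V} {T : Finset V} : T ∈ K.star v ↔ T ∈ K.faces ∧ T.card = 3 ∧ v ∈ T := by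
  rw [star, Set.Finite.mem_toFinset]
  rfl

variable [DecidableEq V]

theorem skeleton_adj_iff {v w : V} : K.skeleton.Adj v w ↔ v ≠ w ∧ ∃ T ∈ K.star v, w ∈ T := by
  refine and_congr_right fun hvw => ⟨fun h => ?_, ?_⟩
  · obtain ⟨T, hT, hsub, hcard⟩ := K.exists_triangle _ h
    rw [Finset.insert_subset_iff, Finset.singleton_subset_iff] at hsub
    exact ⟨T, mem_star.2 ⟨hT, hcard, hsub.1⟩, hsub.2⟩
  · rintro ⟨T, hT, hw⟩
    obtain ⟨hT, -, hv⟩ := mem_star.1 hT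
    refine (K.isRelLowerSet_faces hT).2 ?_ (Finset.insert_nonempty v {w})
    exact Finset.insert_subset hv (Finset.singleton_subset_iff.2 hw)

noncomputable instance : K.skeleton.LocallyFinite := fun v =>
  Set.Finite.fintype <| (((K.star v).biUnion id).finite_toSet).subset fun w hw => by
    obtain ⟨-, T, hT, hwT⟩ := skeleton_adj_iff.1 hw
    exact Finset.mem_coe.2 (Finset.mem_biUnion.2 ⟨T, hT, hwT⟩)

theorem degree_skeleton_pos (v : V) : 0 < K.skeleton.degree v := by
  obtain ⟨T, hT, hsub, hcard⟩ := K.exists_triangle _ (K.singleton_mem v)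
  rw [Finset.singleton_subset_iff] at hsub
  obtain ⟨w, hw, hwv⟩ := Finset.exists_mem_ne (s := T) (by omega) v
  exact (K.skeleton.degree_pos_iff_exists_adj v).2
    ⟨w, skeleton_adj_iff.2 ⟨hwv.symm, T, mem_star.2 ⟨hT, hcard, hsub⟩, hw⟩⟩

/-- The conductance of the edge `v w` for the labels `p` and `q`: an average of the ratios of the
lengths of the edge dual to `v w` and of `v w`. -/
noncomputable def conductance (K : PlaneTriangulation V) (p q : V → ℝ) (v w : V) : ℝ :=
  -- For `v = w` the filter would keep the whole star, giving a nonzero loop.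
  if v = w then 0 else ∑ T ∈ K.star v with w ∈ T, triangleConductance p q T v w

theorem conductance_comm (p q : V → ℝ) (v w : V) :
    K.conductance p q v w = K.conductance p q w v := by
  rw [conductance, conductance]
  simp only [eq_comm (a := w)]
  congr 1
  refine Finset.sum_congr ?_ fun T _ => triangleConductance_comm T v w
  ext T
  simp only [Finset.mem_filter, mem_star]
  tauto

theorem conductance_eq_zero (p q : V → ℝ) {v w : V} (h : ¬ K.skeleton.Adj v w) :
    K.conductance p q v w = 0 := by
  rw [skeleton_adj_iff, not_and'] at h
  rw [conductance]
  split_ifs with hvw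
  · rfl
  · refine Finset.sum_eq_zero fun T hT => ?_
    rw [Finset.mem_filter] at hT
    exact absurd hvw (h ⟨T, hT⟩)

variable {p q : V → ℝ}

theorem conductance_pos (hp : ∀ v, 0 < p v) {v w : V} (h : K.skeleton.Adj v w) :
    0 < K.conductance p q v w := by
  obtain ⟨hvw, T, hT, hw⟩ := skeleton_adj_iff.1 h
  rw [conductance, if_neg hvw]
  exact Finset.sum_pos (fun T hT => triangleConductance_pos hp ⟨w, (Finset.mem_filter.1 hT).2⟩ v w)
    ⟨T, Finset.mem_filter.2 ⟨hT, hw⟩⟩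

/-- Exactly two triangles contain an edge, and each contributes at most 1/2. -/
theorem conductance_le_one (hp : ∀ v, 0 < p v) (v w : V) : K.conductance p q v w ≤ 1 := by
  by_cases h : K.skeleton.Adj v w
  · rw [conductance, if_neg h.1]
    have hcard : ({T ∈ K.star v | w ∈ T} : Finset _).card = 2 := by
      rw [← K.edge_two _ h.2 (Finset.card_pair h.1), ← Set.ncard_coe_finset]
      congr 1
      ext T
      simp only [Finset.coe_filter, mem_star, Set.mem_ofPred_eq, Finset.insert_subset_iff,
        Finset.singleton_subset_iff]
      tauto
    calc ∑ T ∈ K.star v with w ∈ T, triangleConductance p q T v w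
        ≤ ∑ T ∈ K.star v with w ∈ T, 1 / 2 := Finset.sum_le_sum fun T hT => by
          simp only [Finset.mem_filter, mem_star] at hT
          exact triangleConductance_le_half hp hT.1.2.1 hT.1.2.2 hT.2 h.1
      _ = 1 := by rw [Finset.sum_const, hcard]; norm_num
  · rw [conductance_eq_zero p q h]; exact zero_le_one

/-- Sum `angle_sub_angle` over the star of `v` and regroup by the opposite end of each edge. The
right-hand side is the network Laplacian of the log-ratio. -/
theorem angleSum_sub_angleSum (hp : ∀ v, 0 < p v) (hq : ∀ v, 0 < q v) (v : V) :
    K.angleSum q v - K.angleSum p v = ∑ w ∈ K.skeleton.neighborFinset v,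
      K.conductance p q v w * (Real.log (q w / p w) - Real.log (q v / p v)) := by
  rw [angleSum, angleSum, ← Finset.sum_sub_distrib, Finset.sum_congr rfl fun T hT =>
    angle_sub_angle hp hq (mem_star.1 hT).2.1 (mem_star.1 hT).2.2,
    Finset.sum_comm' (t' := K.skeleton.neighborFinset v)
      (s' := fun w => {T ∈ K.star v | w ∈ T})]
  · refine Finset.sum_congr rfl fun w hw => ?_
    have hvw := (skeleton_adj_iff.1 ((SimpleGraph.mem_neighborFinset _ _ _).1 hw)).1
    rw [conductance, if_neg hvw, Finset.sum_mul]
  · intro T w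
    simp only [Finset.mem_erase, Finset.mem_filter, SimpleGraph.mem_neighborFinset,
      skeleton_adj_iff]
    constructor
    · rintro ⟨hT, hwv, hw⟩
      exact ⟨⟨hT, hw⟩, hwv.symm, T, hT, hw⟩
    · rintro ⟨⟨hT, hw⟩, hvw, -⟩
      exact ⟨hT, hvw.symm, hw⟩

end PlaneTriangulation

-- From radii to ratio functions

variable [DecidableEq V] (P Q : CirclePacking K)

theorem exists_radius_div_eq_of_bddAbove (hK : IsRecurrentGraph K.skeleton)
    (hPQ : ∀ v, P.angleSum v = Q.angleSum v)
    (hb : BddAbove (Set.range fun v => Q.radius v / P.radius v)) :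
    ∃ c, ∀ v, Q.radius v / P.radius v = c := by
  have hpos (v : V) : 0 < Q.radius v / P.radius v := div_pos (Q.radius_pos v) (P.radius_pos v)
  obtain ⟨M, hM⟩ := hb
  have hconst := eq_of_harmonic_of_bddAbove (u := fun v => Real.log (Q.radius v / P.radius v)) hK
    PlaneTriangulation.degree_skeleton_pos
    (PlaneTriangulation.conductance_comm P.radius Q.radius)
    (fun _ _ => PlaneTriangulation.conductance_pos P.radius_pos)
    (fun _ _ => PlaneTriangulation.conductance_eq_zero _ _)
    (PlaneTriangulation.conductance_le_one P.radius_pos)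
    -- The log-ratio is bounded on one side only, which suffices for the Liouville property.
    ⟨Real.log M, Set.forall_mem_range.2 fun v =>
      Real.log_le_log (hpos v) (hM (Set.mem_range_self v))⟩
    (fun v => by
      rw [← PlaneTriangulation.angleSum_sub_angleSum P.radius_pos Q.radius_pos]
      exact sub_eq_zero.2 (hPQ v).symm)
  rcases isEmpty_or_nonempty V with h | ⟨⟨o⟩⟩
  · exact ⟨0, fun v => h.elim v⟩
  · exact ⟨Q.radius o / P.radius o, fun v =>
      Real.log_injOn_pos (hpos v) (hpos o) (hconst v o)⟩

theorem bddAbove_of_isBoundedFun (h : IsBoundedFun (ratioFunction P Q)) :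
    BddAbove (Set.range fun v => Q.radius v / P.radius v) := by
  obtain ⟨M, hM⟩ := h
  refine ⟨M, Set.forall_mem_range.2 fun v => ?_⟩
  have hv : (Pi.single v 1 : V → ℝ) ∈ K.polyhedron := by
    refine ⟨fun w => ?_, {v}, K.singleton_mem v, fun w hw => ?_, by simp⟩
    · by_cases h : w = v
      · subst h; simp
      · simp [h]
    · by_contra h
      exact hw (Pi.single_eq_of_ne (by simpa using h) _)
  have hval : ratioFunction P Q ⟨_, hv⟩ = Q.radius v / P.radius v := by
    rw [ratioFunction, finsum_eq_single _ v fun w hw => by simp [hw]]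
    simp
  exact hval ▸ (le_abs_self _).trans (hM ⟨_, hv⟩)

theorem isConstantFun_ratioFunction {c : ℝ} (h : ∀ v, Q.radius v / P.radius v = c) :
    IsConstantFun (ratioFunction P Q) := by
  refine ⟨c, fun ⟨x, _, T, _, hsupp, hsum⟩ => ?_⟩
  simp only [ratioFunction, h]
  rw [finsum_eq_sum_of_support_subset _ (s := T) fun v hv => hsupp fun h0 => hv (by simp [h0]),
    ← Finset.sum_mul, hsum, one_mul]

theorem isConstantFun_of_isBoundedFun (hK : IsRecurrentGraph K.skeleton)
    (hPQ : ∀ v, P.angleSum v = Q.angleSum v) (h : IsBoundedFun (ratioFunction P Q)) :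
    IsConstantFun (ratioFunction P Q) ∧ IsConstantFun (ratioFunction Q P) := by
  obtain ⟨c, hc⟩ :=
    exists_radius_div_eq_of_bddAbove P Q hK hPQ (bddAbove_of_isBoundedFun P Q h)
  exact ⟨isConstantFun_ratioFunction P Q hc,
    -- The two ratio functions need not be reciprocal away from the vertices, so the argument passes
    -- through the vertex values.
    isConstantFun_ratioFunction Q P (c := c⁻¹) fun v => by rw [← hc v, inv_div]⟩

end CirclePack

theorem corollary3p2 {V : Type*} [DecidableEq V] (K : CirclePack.PlaneTriangulation V)
    (hK : CirclePack.IsRecurrentGraph K.skeleton) (P Q : CirclePack.CirclePacking K)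
    (hPQ : ∀ v : V, P.angleSum v = Q.angleSum v) :
    (¬ CirclePack.IsBoundedFun (CirclePack.ratioFunction P Q) ∧
        ¬ CirclePack.IsBoundedFun (CirclePack.ratioFunction Q P)) ∨
      (CirclePack.IsConstantFun (CirclePack.ratioFunction P Q) ∧
        CirclePack.IsConstantFun (CirclePack.ratioFunction Q P)) := by
  by_cases hb : CirclePack.IsBoundedFun (CirclePack.ratioFunction P Q)
  · exact Or.inr (CirclePack.isConstantFun_of_isBoundedFun P Q hK hPQ hb)
  · by_cases hb' : CirclePack.IsBoundedFun (CirclePack.ratioFunction Q P)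
    · exact Or.inr (CirclePack.isConstantFun_of_isBoundedFun Q P hK
        (fun v => (hPQ v).symm) hb').symm
    · exact Or.inl ⟨hb, hb'⟩
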